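/- Let $N$ be a real Lie group whose Lie algebra $\mathfrak n$ is 2-step nilpotent (that is, $[\mathfrak n,[\mathfrak n,\mathfrak n]]=0$) and has a basis with rational structure constants. Let $T^*\mathfrak n=\mathfrak n\ltimes\mathfrak n^*$ be the cotangent Lie algebra, i.e. the semidirect product of $\mathfrak n$ with the abelian Lie algebra $\mathfrak n^*$ via the coadjoint representation, $$[(x,\xi),(y,\eta)]=\bigl([x,y],\,-\eta\circ\mathrm{ad}_x+\xi\circ\mathrm{ad}_y\bigr),$$ with the canonical neutral form $\langle(x,\xi),(y,\eta)\rangle=\xi(y)+\eta(x)$, and let $T^*N$ be the simply connected Lie group with Lie algebra $T^*\mathfrak n$. Then: 1. $\langle\,,\rangle$ is ad-invariant, and there is a bi-invariant pseudo-Riemannian metric $h$ on $T^*N$ which equals $\langle\,,\rangle$ on $T_e(T^*N)=T^*\mathfrak n$. 2. There is a discrete subgroup $\Gamma\subset T^*N$ such that $(T^*N)/\Gamma$ is compact and Hausdorff, $(T^*N)/\Gamma$ has a smooth manifold structure for which the projection $\pi:T^*N\to(T^*N)/\Gamma$ is a local diffeomorphism, and there is a pseudo-Riemannian metric $g$ on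 $(T^*N)/\Gamma$ with $\pi^*g=h$. 3. The pseudo-Riemannian manifold $((T^*N)/\Gamma,g)$ is naturally reductive with respect to the action of $G=T^*N$ by left translations. That is, this action is smooth, transitive, almost effective (its kernel is discrete) and by isometries, and for some base point $o$, with isotropy group $H$ and $\mathfrak h$ the Lie algebra of $H$, the Lie algebra $\mathfrak g$ of $G$ has a subspace $\mathfrak m$ complementary to $\mathfrak h$ with $\mathrm{Ad}(H)\mathfrak m\subseteq\mathfrak m$ and $$\langle[x,y]_{\mathfrak m},z\rangle+\langle y,[x,z]_{\mathfrak m}\rangle=0\quad\text{for all }x,y,z\in\mathfrak m,$$ where $\mathfrak m$ carries the scalar product of the tangent space at $o$, pulled back along the derivative at $e$ of the orbit map $a\mapsto a\cdot o$. -/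

import Mathlib

open scoped Manifold ContDiff

noncomputable section

namespace NilGeom

/-! ### Two-step nilpotent Lie algebras and rational structure constants -/

/-- A Lie algebra is two-step nilpotent (nilpotent of class at most two) if all iterated brackets
`⁅x, ⁅y, z⁆⁆` vanish. -/
class IsTwoStepNilpotent (L : Type*) [LieRing L] : Prop where
  lie_lie_eq_zero : ∀ x y z : L, ⁅x, ⁅y, z⁆⁆ = 0

/-- Some basis of the real Lie algebra `L` has rational structure constants. -/
def HasRationalStructureConstants (L : Type*) [LieRing L] [LieAlgebra ℝ L] : Prop :=
  ∃ (n : ℕ) (b : Module.Basis (Fin n) ℝ L) (c : Fin n → Fin n → Fin n → ℚ),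
    ∀ i j, ⁅b i, b j⁆ = ∑ k, (c i j k : ℝ) • b k

/-! ### The cotangent Lie algebra `T*L = L ⋉ L*` -/

/-- The underlying space `L × L*` of the cotangent Lie algebra. -/
def Cotangent (L : Type*) [LieRing L] [LieAlgebra ℝ L] : Type _ := L × Module.Dual ℝ L

namespace Cotangent

variable {L : Type*} [LieRing L] [LieAlgebra ℝ L]

instance : AddCommGroup (Cotangent L) := inferInstanceAs (AddCommGroup (L × Module.Dual ℝ L))

instance : Module ℝ (Cotangent L) := inferInstanceAs (Module ℝ (L × Module.Dual ℝ L))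

instance [Module.Finite ℝ L] : Module.Finite ℝ (Cotangent L) :=
  inferInstanceAs (Module.Finite ℝ (L × Module.Dual ℝ L))

/-- The coadjoint action, `(ad* x η) z = - η ⁅x, z⁆`. -/
def coad (x : L) (η : Module.Dual ℝ L) : Module.Dual ℝ L :=
  -(η ∘ₗ (LieAlgebra.ad ℝ L x : L →ₗ[ℝ] L))

@[simp] lemma coad_apply (x z : L) (η : Module.Dual ℝ L) : coad x η z = -η ⁅x, z⁆ := rfl

/-- The bracket of the semidirect product of `L` with the abelian Lie algebra `L*` with respect to
the coadjoint representation. -/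
instance : Bracket (Cotangent L) (Cotangent L) where
  bracket X Y := (⁅X.1, Y.1⁆, coad X.1 Y.2 - coad Y.1 X.2)

lemma lie_fst (X Y : Cotangent L) : (⁅X, Y⁆ : Cotangent L).1 = ⁅X.1, Y.1⁆ := rfl

lemma lie_snd_apply (X Y : Cotangent L) (z : L) :
    (⁅X, Y⁆ : Cotangent L).2 z = -Y.2 ⁅X.1, z⁆ + X.2 ⁅Y.1, z⁆ := by
  change (coad X.1 Y.2 - coad Y.1 X.2) z = _
  simp

lemma add_fst (X Y : Cotangent L) : (X + Y).1 = X.1 + Y.1 := rfl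
lemma add_snd (X Y : Cotangent L) : (X + Y).2 = X.2 + Y.2 := rfl
lemma smul_fst (t : ℝ) (X : Cotangent L) : (t • X).1 = t • X.1 := rfl
lemma smul_snd (t : ℝ) (X : Cotangent L) : (t • X).2 = t • X.2 := rfl
lemma zero_fst : (0 : Cotangent L).1 = 0 := rfl
lemma zero_snd : (0 : Cotangent L).2 = 0 := rfl

lemma ext' {X Y : Cotangent L} (h₁ : X.1 = Y.1) (h₂ : ∀ z, X.2 z = Y.2 z) : X = Y :=
  Prod.ext h₁ (LinearMap.ext h₂)

instance : LieRing (Cotangent L) where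
  add_lie X Y Z := by
    refine ext' ?_ fun z => ?_
    · simp [lie_fst, add_fst]
    · simp [lie_snd_apply, add_fst, add_snd]; abel
  lie_add X Y Z := by
    refine ext' ?_ fun z => ?_
    · simp [lie_fst, add_fst]
    · simp [lie_snd_apply, add_fst, add_snd]; abel
  lie_self X := by
    refine ext' ?_ fun z => ?_
    · simp [lie_fst, zero_fst]
    · simp [lie_snd_apply, zero_snd]
  leibniz_lie X Y Z := by
    refine ext' ?_ fun z => ?_
    · simp [lie_fst, add_fst]
    · simp only [lie_snd_apply, lie_fst, add_snd, LinearMap.add_apply, lie_lie, map_sub]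
      abel

instance : LieAlgebra ℝ (Cotangent L) where
  lie_smul t X Y := by
    refine ext' ?_ fun z => ?_
    · simp [lie_fst, smul_fst]
    · simp [lie_snd_apply, smul_fst, smul_snd]; ring

instance [IsTwoStepNilpotent L] : IsTwoStepNilpotent (Cotangent L) where
  lie_lie_eq_zero X Y Z := by
    have h : ∀ x y z : L, ⁅x, ⁅y, z⁆⁆ = 0 := IsTwoStepNilpotent.lie_lie_eq_zero
    have h' : ∀ x y z : L, ⁅⁅x, y⁆, z⁆ = 0 := fun x y z => by rw [← lie_skew, h, neg_zero]
    refine ext' ?_ fun z => ?_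
    · simp [lie_fst, zero_fst, h]
    · simp [lie_snd_apply, lie_fst, zero_snd, h, h']

/-- The canonical neutral form `⟨(x, ξ), (y, η)⟩ = ξ y + η x` on `L × L*`. -/
def canonicalForm (X Y : Cotangent L) : ℝ := X.2 Y.1 + Y.2 X.1

end Cotangent

/-! ### The simply connected Lie group of a two-step nilpotent Lie algebra -/

section Model

variable (𝔤 : Type*) [LieRing 𝔤] [LieAlgebra ℝ 𝔤] [Module.Finite ℝ 𝔤]

/-- The vector space underlying `𝔤`, with a norm (the Euclidean norm in some basis; as `𝔤` is
finite-dimensional, its topology and smooth structure do not depend on the choice). -/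
def Model (𝔤 : Type*) : Type _ := 𝔤

instance : AddCommGroup (Model 𝔤) := inferInstanceAs (AddCommGroup 𝔤)

instance : Module ℝ (Model 𝔤) := inferInstanceAs (Module ℝ 𝔤)

instance : Module.Finite ℝ (Model 𝔤) := inferInstanceAs (Module.Finite ℝ 𝔤)

/-- Coordinates in some basis. -/
def Model.coords : Model 𝔤 ≃ₗ[ℝ] EuclideanSpace ℝ (Fin (Module.finrank ℝ (Model 𝔤))) :=
  (Module.finBasis ℝ (Model 𝔤)).equivFun ≪≫ₗ (WithLp.linearEquiv 2 ℝ _).symm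

instance : NormedAddCommGroup (Model 𝔤) :=
  NormedAddCommGroup.induced _ _ (Model.coords 𝔤) (Model.coords 𝔤).injective

instance : NormedSpace ℝ (Model 𝔤) :=
  NormedSpace.induced ℝ _ _ (Model.coords 𝔤)

/-- The simply connected Lie group with two-step nilpotent Lie algebra `𝔤`: the manifold is the
vector space `𝔤`, the product is `x * y = x + y + ½ ⁅x, y⁆` (the Baker–Campbell–Hausdorff product).
-/
def SCGroup (𝔤 : Type*) : Type _ := 𝔤

namespace SCGroup

variable {𝔤}

/-- The identity map, from the vector space to the group (this is the exponential map). -/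
def of (x : 𝔤) : SCGroup 𝔤 := x

/-- The identity map, from the group to the vector space. -/
def val (p : SCGroup 𝔤) : 𝔤 := p

instance : TopologicalSpace (SCGroup 𝔤) := inferInstanceAs (TopologicalSpace (Model 𝔤))

/-- The smooth structure is that of the vector space. -/
instance : ChartedSpace (Model 𝔤) (SCGroup 𝔤) :=
  inferInstanceAs (ChartedSpace (Model 𝔤) (Model 𝔤))

instance : SimplyConnectedSpace (SCGroup 𝔤) :=
  inferInstanceAs (SimplyConnectedSpace (Model 𝔤))

variable [IsTwoStepNilpotent 𝔤]

instance : Group (SCGroup 𝔤) where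
  mul p q := of (p.val + q.val + (1 / 2 : ℝ) • ⁅p.val, q.val⁆)
  one := of 0
  inv p := of (-p.val)
  mul_assoc p q r := by
    have h : ∀ x y z : 𝔤, ⁅x, ⁅y, z⁆⁆ = 0 := IsTwoStepNilpotent.lie_lie_eq_zero
    have h' : ∀ x y z : 𝔤, ⁅⁅x, y⁆, z⁆ = 0 := fun x y z => by rw [← lie_skew, h, neg_zero]
    change (_ + (_ : 𝔤) + (1 / 2 : ℝ) • ⁅_, (_ : 𝔤)⁆ : 𝔤) = _ + _ + (1 / 2 : ℝ) • ⁅(_ : 𝔤), (_ : 𝔤)⁆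
    change (p.val + q.val + (1 / 2 : ℝ) • ⁅p.val, q.val⁆) + r.val
        + (1 / 2 : ℝ) • ⁅p.val + q.val + (1 / 2 : ℝ) • ⁅p.val, q.val⁆, r.val⁆
      = p.val + (q.val + r.val + (1 / 2 : ℝ) • ⁅q.val, r.val⁆)
        + (1 / 2 : ℝ) • ⁅p.val, q.val + r.val + (1 / 2 : ℝ) • ⁅q.val, r.val⁆⁆
    simp only [add_lie, lie_add, smul_lie, lie_smul, h, h', smul_zero, add_zero, smul_add]
    abel
  one_mul p := by
    change (0 : 𝔤) + p.val + (1 / 2 : ℝ) • ⁅(0 : 𝔤), p.val⁆ = p.val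
    simp
  mul_one p := by
    change p.val + (0 : 𝔤) + (1 / 2 : ℝ) • ⁅p.val, (0 : 𝔤)⁆ = p.val
    simp
  inv_mul_cancel p := by
    change -p.val + p.val + (1 / 2 : ℝ) • ⁅-p.val, p.val⁆ = (0 : 𝔤)
    simp

end SCGroup

/-- The bracket as a continuous bilinear map on the underlying normed space. -/
def Model.bracketCLM : Model 𝔤 →L[ℝ] Model 𝔤 →L[ℝ] Model 𝔤 :=
  LinearMap.toContinuousLinearMap
    ((LinearMap.toContinuousLinearMap : (Model 𝔤 →ₗ[ℝ] Model 𝔤) ≃ₗ[ℝ] _).toLinearMap ∘ₗ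
      (LinearMap.mk₂ ℝ (fun x y : 𝔤 => (⁅x, y⁆ : 𝔤)) add_lie smul_lie lie_add
        (fun t x y => lie_smul t x y) : 𝔤 →ₗ[ℝ] 𝔤 →ₗ[ℝ] 𝔤))

lemma Model.bracketCLM_apply (x y : 𝔤) : Model.bracketCLM 𝔤 x y = ⁅x, y⁆ := rfl

end Model

section Calculus

variable {V : Type*} [NormedAddCommGroup V] [NormedSpace ℝ V] (B : V →L[ℝ] V →L[ℝ] V)

lemma contMDiff_bilin_mul {n : WithTop ℕ∞} :
    ContMDiff (𝓘(ℝ, V).prod 𝓘(ℝ, V)) 𝓘(ℝ, V) n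
      (fun p : V × V => p.1 + p.2 + (1 / 2 : ℝ) • B p.1 p.2) := by
  rw [← modelWithCornersSelf_prod, chartedSpaceSelf_prod, contMDiff_iff_contDiff]
  fun_prop

lemma contMDiff_neg_self {n : WithTop ℕ∞} :
    ContMDiff 𝓘(ℝ, V) 𝓘(ℝ, V) n (fun p : V => -p) := by
  rw [contMDiff_iff_contDiff]
  fun_prop

lemma mfderiv_bilin_mul (p v : V) :
    (mfderiv 𝓘(ℝ, V) 𝓘(ℝ, V) (fun q : V => p + q + (1 / 2 : ℝ) • B p q) (0 : V) v : V) =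
      v + (1 / 2 : ℝ) • B p v := by
  have h : HasFDerivAt (fun q : V => p + q + (1 / 2 : ℝ) • B p q)
      (ContinuousLinearMap.id ℝ V + (1 / 2 : ℝ) • B p) (0 : V) :=
    ((hasFDerivAt_id _).const_add p).add ((B p).hasFDerivAt.const_smul (1 / 2 : ℝ))
  rw [mfderiv_eq_fderiv, h.fderiv]
  rfl

lemma mlieBracket_eq_lieBracket (X Y : (x : V) → TangentSpace 𝓘(ℝ, V) x) :
    VectorField.mlieBracket 𝓘(ℝ, V) X Y = VectorField.lieBracket ℝ X Y := by
  rw [← VectorField.mlieBracketWithin_univ, VectorField.mlieBracketWithin_eq_lieBracketWithin]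
  exact VectorField.lieBracketWithin_univ

lemma mlieBracket_bilin (v w : V) :
    (VectorField.mlieBracket 𝓘(ℝ, V) (fun p : V => (v + (1 / 2 : ℝ) • B p v : V))
      (fun p : V => (w + (1 / 2 : ℝ) • B p w : V)) (0 : V) : V) =
      (1 / 2 : ℝ) • B v w - (1 / 2 : ℝ) • B w v := by
  have key : ∀ u : V, HasFDerivAt (fun p : V => u + (1 / 2 : ℝ) • B p u)
      ((1 / 2 : ℝ) • B.flip u) (0 : V) := fun u =>
    ((B.flip u).hasFDerivAt.const_smul (1 / 2 : ℝ)).const_add u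
  refine (congrFun (mlieBracket_eq_lieBracket _ _) (0 : V)).trans ?_
  simp only [VectorField.lieBracket]
  erw [(key v).fderiv, (key w).fderiv]
  simp
  rfl

end Calculus

section Group

variable {𝔤 : Type*} [LieRing 𝔤] [LieAlgebra ℝ 𝔤] [Module.Finite ℝ 𝔤] [IsTwoStepNilpotent 𝔤]

namespace SCGroup

instance {n : WithTop ℕ∞} : LieGroup 𝓘(ℝ, Model 𝔤) n (SCGroup 𝔤) where
  toIsManifold := inferInstanceAs (IsManifold 𝓘(ℝ, Model 𝔤) n (Model 𝔤))
  contMDiff_mul := contMDiff_bilin_mul (Model.bracketCLM 𝔤)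
  contMDiff_inv := contMDiff_neg_self (V := Model 𝔤)

lemma mulInvariantVectorField_eq (v p : Model 𝔤) :
    mulInvariantVectorField (I := 𝓘(ℝ, Model 𝔤)) (G := SCGroup 𝔤) v p =
      v + (1 / 2 : ℝ) • Model.bracketCLM 𝔤 p v :=
  mfderiv_bilin_mul (Model.bracketCLM 𝔤) p v

lemma lie_eq (v w : Model 𝔤) :
    ⁅(show GroupLieAlgebra 𝓘(ℝ, Model 𝔤) (SCGroup 𝔤) from v),
      (show GroupLieAlgebra 𝓘(ℝ, Model 𝔤) (SCGroup 𝔤) from w)⁆ = Model.bracketCLM 𝔤 v w := by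
  have h1 : ∀ u : Model 𝔤, mulInvariantVectorField (I := 𝓘(ℝ, Model 𝔤)) (G := SCGroup 𝔤) u =
      fun p : Model 𝔤 => u + (1 / 2 : ℝ) • Model.bracketCLM 𝔤 p u :=
    fun u => funext fun p => mulInvariantVectorField_eq u p
  rw [GroupLieAlgebra.bracket_def]
  erw [h1 v, h1 w]
  refine (mlieBracket_bilin (Model.bracketCLM 𝔤) v w).trans ?_
  have h2 : Model.bracketCLM 𝔤 w v = -Model.bracketCLM 𝔤 v w := by
    erw [Model.bracketCLM_apply, Model.bracketCLM_apply]
    exact (lie_skew (L := 𝔤) w v).symm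
  rw [h2, smul_neg, sub_neg_eq_add, ← add_smul]
  norm_num
  rfl

/-- The Lie algebra of left-invariant vector fields of `SCGroup 𝔤` is `𝔤`, through the identity
map. -/
def lieAlgebraEquiv : GroupLieAlgebra 𝓘(ℝ, Model 𝔤) (SCGroup 𝔤) ≃ₗ⁅ℝ⁆ 𝔤 where
  toFun v := v
  invFun v := v
  map_add' _ _ := rfl
  map_smul' _ _ := rfl
  map_lie' {v w} := lie_eq v w
  left_inv _ := rfl
  right_inv _ := rfl

end SCGroup

end Group

/-- A smooth real Lie group has the smoothness that its Lie algebra structure asks for. -/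
instance {E : Type*} [NormedAddCommGroup E] [NormedSpace ℝ E] {H : Type*} [TopologicalSpace H]
    {I : ModelWithCorners ℝ E H} {G : Type*} [TopologicalSpace G] [ChartedSpace H G] [Group G]
    [LieGroup I ∞ G] : LieGroup I (minSmoothness ℝ 3) G := by
  rw [minSmoothness_of_isRCLikeNormedField]
  infer_instance

/-! ### Pseudo-Riemannian metrics and naturally reductive spaces -/

section PseudoRiemannian

variable {E : Type*} [NormedAddCommGroup E] [NormedSpace ℝ E] {H : Type*} [TopologicalSpace H]
  (I : ModelWithCorners ℝ E H)
  (M : Type*) [TopologicalSpace M] [ChartedSpace H M] [IsManifold I ∞ M]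

/-- A smooth pseudo-Riemannian metric: a smooth field of nondegenerate symmetric bilinear forms on
the tangent spaces. -/
structure PseudoRiemannianMetric where
  /-- The scalar product on the tangent space at `x`. -/
  val (x : M) : TangentSpace I x →L[ℝ] TangentSpace I x →L[ℝ] ℝ
  symm (x : M) (v w : TangentSpace I x) : val x v w = val x w v
  nondegenerate (x : M) (v : TangentSpace I x) (hv : ∀ w, val x v w = 0) : v = 0
  contMDiff : ContMDiff I (I.prod 𝓘(ℝ, E →L[ℝ] E →L[ℝ] ℝ)) ∞
    (fun x ↦ Bundle.TotalSpace.mk' (E →L[ℝ] E →L[ℝ] ℝ)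
      (E := fun x : M ↦ TangentSpace I x →L[ℝ] TangentSpace I x →L[ℝ] ℝ) x (val x))

variable {I M}
variable {E' : Type*} [NormedAddCommGroup E'] [NormedSpace ℝ E'] {H' : Type*}
  [TopologicalSpace H'] {I' : ModelWithCorners ℝ E' H'}
  {M' : Type*} [TopologicalSpace M'] [ChartedSpace H' M'] [IsManifold I' ∞ M']

/-- The map `f` preserves the metrics: `g = f^* g'`. -/
def PseudoRiemannianMetric.IsPreservedBy (g : PseudoRiemannianMetric I M)
    (g' : PseudoRiemannianMetric I' M') (f : M → M') : Prop :=
  ∀ (x : M) (v w : TangentSpace I x),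
    g'.val (f x) (mfderiv I I' f x v) (mfderiv I I' f x w) = g.val x v w

end PseudoRiemannian

section LieGroup

variable {E : Type*} [NormedAddCommGroup E] [NormedSpace ℝ E] {H : Type*} [TopologicalSpace H]
  (I : ModelWithCorners ℝ E H)
  {G : Type*} [TopologicalSpace G] [ChartedSpace H G] [Group G] [LieGroup I ∞ G]

/-- `𝔥` is the Lie algebra of the subgroup `K` of `G`: it consists of those `X` whose one-parameter
subgroup `t ↦ exp (t X)`, the integral curve through `1` of the left-invariant vector field of
`X`, stays in `K`. -/
def IsLieAlgebraOf (𝔥 : Submodule ℝ (GroupLieAlgebra I G)) (K : Subgroup G) : Prop :=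
  ∀ X : GroupLieAlgebra I G, X ∈ 𝔥 ↔
    ∃ γ : ℝ → G, γ 0 = 1 ∧ IsMIntegralCurve (I := I) γ (mulInvariantVectorField X) ∧ ∀ t, γ t ∈ K

/-- The adjoint representation: the derivative at `1` of the conjugation by `a`. -/
def adjoint (a : G) (X : GroupLieAlgebra I G) : GroupLieAlgebra I G :=
  (show E from mfderiv I I (fun x : G ↦ a * x * a⁻¹) 1 X)

variable {E' : Type*} [NormedAddCommGroup E'] [NormedSpace ℝ E'] {H' : Type*}
  [TopologicalSpace H'] (I' : ModelWithCorners ℝ E' H')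
  {M : Type*} [TopologicalSpace M] [ChartedSpace H' M] [IsManifold I' ∞ M] [MulAction G M]

/-- The scalar product on the Lie algebra of `G` pulled back from the tangent space of `M` at the
base point `o` along the derivative at `1` of the orbit map `a ↦ a • o`. -/
def pullbackForm (g : PseudoRiemannianMetric I' M) (o : M) (X Y : GroupLieAlgebra I G) : ℝ :=
  g.val ((1 : G) • o) (mfderiv I I' (fun a : G ↦ a • o) 1 X)
    (mfderiv I I' (fun a : G ↦ a • o) 1 Y)

variable (G) in
/-- The pseudo-Riemannian manifold `(M, g)` is naturally reductive with respect to the Lie group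
`G` of isometries, acting smoothly, transitively and almost effectively on `M`: for some base point
`o` with isotropy algebra `𝔥`, there is a complement `𝔪` of `𝔥` in the Lie algebra of `G` with
`Ad(K) 𝔪 ⊆ 𝔪` for the isotropy group `K` and
`⟨[x, y]_𝔪, z⟩ + ⟨y, [x, z]_𝔪⟩ = 0` on `𝔪`, where `𝔪` is identified with the tangent space at `o`. -/
structure IsNaturallyReductive (g : PseudoRiemannianMetric I' M) : Prop where
  t2 : T2Space G
  secondCountable : SecondCountableTopology G
  smooth : ContMDiffSMul I I' ∞ G M
  transitive : MulAction.IsPretransitive G M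
  almostEffective : DiscreteTopology (MulAction.toPermHom G M).ker
  isometry : ∀ a : G, g.IsPreservedBy g (fun x : M ↦ a • x)
  exists_reductive : ∃ (o : M) (𝔥 𝔪 : Submodule ℝ (GroupLieAlgebra I G)) (h𝔪 : IsCompl 𝔪 𝔥),
    IsLieAlgebraOf I 𝔥 (MulAction.stabilizer G o) ∧
    (∀ a ∈ MulAction.stabilizer G o, ∀ X ∈ 𝔪, adjoint I a X ∈ 𝔪) ∧
    ∀ X ∈ 𝔪, ∀ Y ∈ 𝔪, ∀ Z ∈ 𝔪,
      pullbackForm I I' g o (𝔪.projection 𝔥 h𝔪 ⁅X, Y⁆) Z +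
        pullbackForm I I' g o Y (𝔪.projection 𝔥 h𝔪 ⁅X, Z⁆) = 0

end LieGroup

/-! ### The cotangent group of a Lie group -/

section CotangentGroup

variable (E : Type*) [NormedAddCommGroup E] [NormedSpace ℝ E] [FiniteDimensional ℝ E]
  (N : Type*) [TopologicalSpace N] [ChartedSpace E N] [Group N]

instance : Module.Finite ℝ (GroupLieAlgebra 𝓘(ℝ, E) N) := inferInstanceAs (Module.Finite ℝ E)

variable [LieGroup 𝓘(ℝ, E) ∞ N]

/-- The cotangent Lie algebra `T*𝔫` of the Lie algebra `𝔫` of the Lie group `N`. -/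
abbrev CotangentLieAlgebra : Type _ := Cotangent (GroupLieAlgebra 𝓘(ℝ, E) N)

/-- The cotangent Lie group `T*N`: the simply connected Lie group with Lie algebra `T*𝔫`. -/
abbrev CotangentGroup : Type _ := SCGroup (CotangentLieAlgebra E N)

/-- The model with corners of `T*N` and of its quotients by discrete subgroups. -/
abbrev cotangentModel := 𝓘(ℝ, Model (CotangentLieAlgebra E N))

end CotangentGroup

end NilGeom
end

open scoped Manifold ContDiff

noncomputable section

/-! In exponential coordinates the product is `x + y + ½⁅x, y⁆`, so translations by `a` have
derivative `id ± ½ ad a`. For an ad-invariant form on a two-step algebra this map is an isometry: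
the cross terms cancel by skewness, and `β ⁅a, v⁆ ⁅a, w⁆ = -β v ⁅a, ⁅a, w⁆⁆ = 0`
(`adInvariant_half_bracket`). Hence the bi-invariant metric is just the constant form on the vector
space.

A rational basis of `𝔫` and its dual basis form a rational basis of `T*𝔫`. Rescaling makes the
structure constants even, which absorbs the `½` in the product, so the integral span is a discrete
subgroup `Γ`; it is cocompact by splitting coordinates into integral and fractional parts
(`compactSpace_quotient_lattice`).

The charts of the quotient are the local inverses of the projection. Changes of charts are locally
right translations by elements of `Γ`, which are smooth and preserve the constant form, so manifold
structure and metric descend.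

The isotropy group of the base coset is `Γ`, so `𝔥 = 0`, `𝔪 = 𝔤`, and natural reductivity reduces to
ad-invariance. -/

namespace NilGeom

/-! ### Constant metrics and their descent along a local homeomorphism -/

section ConstantMetric

open Topology

variable {V : Type*} [NormedAddCommGroup V] [NormedSpace ℝ V]

/-- The metric which is the same bilinear form `B` in all preferred charts, if the changes of
coordinates preserve `B`. -/
def PseudoRiemannianMetric.const {M : Type*} [TopologicalSpace M] [ChartedSpace V M]
    [IsManifold 𝓘(ℝ, V) ∞ M] (B : V →L[ℝ] V →L[ℝ] ℝ) (hsymm : ∀ v w, B v w = B w v)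
    (hnd : ∀ v, (∀ w, B v w = 0) → v = 0)
    (hB : ∀ x₀ x : M, x ∈ (chartAt V x₀).source → ∀ v w : V,
      B (tangentCoordChange 𝓘(ℝ, V) x₀ x x v) (tangentCoordChange 𝓘(ℝ, V) x₀ x x w) = B v w) :
    PseudoRiemannianMetric 𝓘(ℝ, V) M where
  val _ := B
  symm _ := hsymm
  nondegenerate _ := hnd
  contMDiff x₀ := by
    rw [contMDiffAt_hom_bundle]
    refine ⟨contMDiffAt_id, ?_⟩
    -- Read in the trivialization at `x₀`, the field is the pullback of `B` under a coordinate
    -- change, which is `B` again by `hB`; so it is locally constant.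
    refine (contMDiffAt_const (c := B)).congr_of_eventuallyEq ?_
    filter_upwards [(chartAt V x₀).open_source.mem_nhds (mem_chart_source V x₀)] with x hx
    refine ContinuousLinearMap.ext fun v => ContinuousLinearMap.ext fun w => ?_
    refine (inCoordinates_apply_eq₂ (F₁ := V) (F₂ := V) (F₃ := ℝ)
      (E₁ := TangentSpace 𝓘(ℝ, V)) (E₂ := TangentSpace 𝓘(ℝ, V)) (E₃ := fun _ : M => ℝ)
      (x₀ := x₀) (x := x) hx hx (Set.mem_univ _)).trans ?_
    have key : ∀ u : V, (trivializationAt V (TangentSpace 𝓘(ℝ, V)) x₀).symm x u =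
        tangentCoordChange 𝓘(ℝ, V) x₀ x x u := fun u => by
      rw [← Bundle.Trivialization.symmL_apply (R := ℝ),
        TangentBundle.symmL_trivializationAt_eq_core hx]
      · rfl
      · exact hx
    rw [key, key]
    refine Eq.trans ?_ (hB x₀ x hx v w)
    simp
    rfl

/-- The constant metric on a vector space. -/
def PseudoRiemannianMetric.constSelf (B : V →L[ℝ] V →L[ℝ] ℝ) (hsymm : ∀ v w, B v w = B w v)
    (hnd : ∀ v, (∀ w, B v w = 0) → v = 0) : PseudoRiemannianMetric 𝓘(ℝ, V) V :=
  .const B hsymm hnd fun x₀ x _ v w => by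
    have h : tangentCoordChange 𝓘(ℝ, V) x₀ x x = ContinuousLinearMap.id ℝ V :=
      tangentBundleCore_coordChange_model_space x₀ x x
    rw [h]
    rfl

variable {M : Type*} [TopologicalSpace M]

/-- Any two points in a fibre of `π` are related by a smooth map over `π` which preserves `B`. -/
def HasIsometricDeckMaps (π : V → M) (B : V →L[ℝ] V →L[ℝ] ℝ) : Prop :=
  ∀ x y, π x = π y → ∃ T : V → V, ContDiff ℝ ∞ T ∧ T x = y ∧ (∀ z, π (T z) = π z) ∧
    ∀ z v w, B (fderiv ℝ T z v) (fderiv ℝ T z w) = B v w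

/-- The charts are the local inverses of the local homeomorphism `π`. -/
@[reducible]
def localInverseChartedSpace {π : V → M} (hπ : IsLocalHomeomorph π)
    (hs : Function.Surjective π) : ChartedSpace V M where
  -- An equality of total functions, not only on the target. Taking all such `e` makes membership in
  -- the atlas unfold to this equation.
  atlas := {e | ⇑e.symm = π}
  chartAt q := hπ.localInverseAt (Function.surjInv hs q)
  mem_chart_source q := by
    have h := hπ.apply_self_mem_localInverseAt_source (x := Function.surjInv hs q)
    rwa [Function.surjInv_eq hs q] at h
  chart_mem_atlas q := hπ.localInverseAt_symm _

variable {π : V → M} {B : V →L[ℝ] V →L[ℝ] ℝ}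

/-- Since `x` and `e (π x)` lie in one fibre, a deck map `T` joins them. Near `x` it stays in the
target of `e`, where `e` inverts `π`, so `e (π z) = e (π (T z)) = T z`. This controls both the
changes of charts and the chart expression of `π`. -/
lemma HasIsometricDeckMaps.exists_eventuallyEq (hT : HasIsometricDeckMaps π B)
    (e : OpenPartialHomeomorph M V) (he : ⇑e.symm = π) {x : V} (hx : π x ∈ e.source) :
    ∃ T : V → V, ContDiff ℝ ∞ T ∧ (∀ z v w, B (fderiv ℝ T z v) (fderiv ℝ T z w) = B v w) ∧
      e ∘ π =ᶠ[𝓝 x] T := by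
  obtain ⟨T, hTs, hTx, hTπ, hTB⟩ := hT x (e (π x)) (by rw [← he, he]; simpa [he] using
    (e.left_inv hx).symm)
  refine ⟨T, hTs, hTB, ?_⟩
  have : ∀ᶠ z in 𝓝 x, T z ∈ e.target :=
    hTs.continuous.continuousAt.eventually (e.open_target.mem_nhds (hTx ▸ e.map_source hx))
  filter_upwards [this] with z hz
  have := e.right_inv hz
  rw [he, hTπ] at this
  exact this

lemma HasIsometricDeckMaps.isManifold [ChartedSpace V M] (hT : HasIsometricDeckMaps π B)
    (hatlas : ∀ e ∈ atlas V M, ⇑e.symm = π) : IsManifold 𝓘(ℝ, V) ∞ M := by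
  refine isManifold_of_contDiffOn _ _ _ fun e e' he he' u hu => ContDiffAt.contDiffWithinAt ?_
  simp only [mfld_simps] at hu ⊢
  rw [hatlas e he] at hu ⊢
  obtain ⟨T, hTs, -, hTe⟩ := hT.exists_eventuallyEq e' (hatlas e' he') hu.2
  exact hTs.contDiffAt.congr_of_eventuallyEq hTe

lemma isLocalDiffeomorph_of_atlas [ChartedSpace V M] [IsManifold 𝓘(ℝ, V) ∞ M]
    (hπ : IsLocalHomeomorph π) (hatlas : ∀ e : OpenPartialHomeomorph M V, ⇑e.symm = π →
      e ∈ atlas V M) : IsLocalDiffeomorph 𝓘(ℝ, V) 𝓘(ℝ, V) ∞ π := fun x => by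
  have he := hatlas _ (hπ.localInverseAt_symm x)
  have he' := IsManifold.subset_maximalAtlas (I := 𝓘(ℝ, V)) (n := ∞) he
  refine ⟨{ (hπ.localInverseAt x).symm with
    contMDiffOn_toFun := contMDiffOn_symm_of_mem_maximalAtlas he'
    contMDiffOn_invFun := contMDiffOn_of_mem_maximalAtlas he' }, ?_, ?_⟩
  · exact hπ.self_mem_localInverseAt_target
  · intro y _
    exact (congrFun (hπ.localInverseAt_symm x) y).symm

/-- The metric on `M` for which `π` is a local isometry, if `V` carries the constant metric `B`. -/
def HasIsometricDeckMaps.metric [ChartedSpace V M] [IsManifold 𝓘(ℝ, V) ∞ M]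
    (hT : HasIsometricDeckMaps π B) (hatlas : ∀ e ∈ atlas V M, ⇑e.symm = π)
    (hsymm : ∀ v w, B v w = B w v) (hnd : ∀ v, (∀ w, B v w = 0) → v = 0) :
    PseudoRiemannianMetric 𝓘(ℝ, V) M :=
  .const B hsymm hnd fun x₀ x hx v w => by
    have h₀ := hatlas _ (chart_mem_atlas V x₀)
    have h : π (chartAt V x₀ x) = x := by rw [← h₀]; exact (chartAt V x₀).left_inv hx
    obtain ⟨T, -, hTB, hTe⟩ := hT.exists_eventuallyEq (x := chartAt V x₀ x) (chartAt V x)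
      (hatlas _ (chart_mem_atlas V x)) (by rw [h]; exact mem_chart_source V x)
    -- The change of charts is `chartAt V x ∘ π`, because the inverse of the chart at `x₀` is `π`;
    -- near the point it is the deck map `T`.
    have key : tangentCoordChange 𝓘(ℝ, V) x₀ x x = fderiv ℝ T (chartAt V x₀ x) := by
      rw [tangentCoordChange_def, ← hTe.fderiv_eq]
      simp only [mfld_simps, fderivWithin_univ]
      rw [h₀]
    rw [key, hTB]

lemma HasIsometricDeckMaps.isPreservedBy [ChartedSpace V M] [IsManifold 𝓘(ℝ, V) ∞ M]
    (hT : HasIsometricDeckMaps π B) (hatlas : ∀ e ∈ atlas V M, ⇑e.symm = π)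
    (hsymm : ∀ v w, B v w = B w v) (hnd : ∀ v, (∀ w, B v w = 0) → v = 0)
    (hd : MDifferentiable 𝓘(ℝ, V) 𝓘(ℝ, V) π) :
    (PseudoRiemannianMetric.constSelf B hsymm hnd).IsPreservedBy
      (hT.metric hatlas hsymm hnd) π := fun x v w => by
  obtain ⟨T, -, hTB, hTe⟩ := hT.exists_eventuallyEq (x := x) (chartAt V (π x))
    (hatlas _ (chart_mem_atlas V _)) (mem_chart_source V _)
  have key : mfderiv 𝓘(ℝ, V) 𝓘(ℝ, V) π x = fderiv ℝ T x := by
    rw [(hd x).mfderiv, ← hTe.fderiv_eq]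
    simp only [mfld_simps, fderivWithin_univ, writtenInExtChartAt]
    rfl
  rw [key]
  exact hTB x v w

end ConstantMetric

/-! ### Isometries of the base from isometries upstairs -/

section Descent

variable {E : Type*} [NormedAddCommGroup E] [NormedSpace ℝ E]
  {H : Type*} [TopologicalSpace H] {I : ModelWithCorners ℝ E H}
  {P : Type*} [TopologicalSpace P] [ChartedSpace H P] [IsManifold I ∞ P]
  {E' : Type*} [NormedAddCommGroup E'] [NormedSpace ℝ E']
  {H' : Type*} [TopologicalSpace H'] {I' : ModelWithCorners ℝ E' H'}
  {M : Type*} [TopologicalSpace M] [ChartedSpace H' M] [IsManifold I' ∞ M]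

/-- Let `π` be a surjective local isometry. A map of the base which lifts along `π` to a map
preserving the metric preserves the metric. -/
lemma PseudoRiemannianMetric.IsPreservedBy.descend {h : PseudoRiemannianMetric I P}
    {g : PseudoRiemannianMetric I' M} {π : P → M} (hπ : IsLocalDiffeomorph I I' ∞ π)
    (hs : Function.Surjective π) (hgh : h.IsPreservedBy g π) {F : P → P} {f : M → M}
    (hF : h.IsPreservedBy h F) (hFd : MDifferentiable I I F) (hfd : MDifferentiable I' I' f)
    (hfF : f ∘ π = π ∘ F) : g.IsPreservedBy g f := fun m v w => by
  obtain ⟨x, rfl⟩ := hs m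
  have hd := hπ.mdifferentiable (by simp)
  have hsurj : Function.Surjective (mfderiv I I' π x) := fun u => by
    obtain ⟨a, ha⟩ := (hπ.mfderivToContinuousLinearEquiv (by simp) x).surjective u
    refine ⟨a, ?_⟩
    rw [← ha, ← hπ.mfderivToContinuousLinearEquiv_coe (by simp)]
    rfl
  obtain ⟨v, rfl⟩ := hsurj v
  obtain ⟨w, rfl⟩ := hsurj w
  have h1 : ∀ u, mfderiv I' I' f (π x) (mfderiv I I' π x u) =
      mfderiv I I' (f ∘ π) x u := fun u => by
    rw [mfderiv_comp x (hfd _) (hd x)]; rfl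
  have h2 : ∀ u, mfderiv I I' (π ∘ F) x u = mfderiv I I' π (F x) (mfderiv I I F x u) := fun u => by
    rw [mfderiv_comp x (hd _) (hFd x)]; rfl
  rw [h1, h1, hgh x]
  have h3 := hgh (F x) (mfderiv I I F x v) (mfderiv I I F x w)
  rw [← h2, ← h2, hF x v w, ← hfF] at h3
  rw [← h3]
  -- The base points `f (π x)` and `π (F x)` are equal only propositionally; vectors in both tangent
  -- spaces are elements of `E'`.
  have h4 : ∀ a b : M, a = b → ∀ v w : E', g.val a v w = g.val b v w := by
    rintro a _ rfl v w; rfl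
  exact h4 _ _ (congrFun hfF x) _ _

end Descent

/-! ### Lattices from rational structure constants -/

section Lattice

variable {𝔤 : Type*} [LieRing 𝔤] [LieAlgebra ℝ 𝔤]

/-- A rational basis of the Lie algebra can be rescaled such that the structure constants become
even integers. -/
lemma exists_basis_lie_eq_two_smul {ι : Type*} [Fintype ι] (b : Module.Basis ι ℝ 𝔤)
    (h : ∀ i j, ∃ c : ι → ℚ, ⁅b i, b j⁆ = ∑ k, (c k : ℝ) • b k) :
    ∃ e : Module.Basis ι ℝ 𝔤, ∀ i j, ∃ y ∈ Submodule.span ℤ (Set.range e),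
      ⁅e i, e j⁆ = (2 : ℝ) • y := by
  choose c hc using h
  obtain ⟨D, hD⟩ := IsLocalization.exist_integer_multiples_of_finite (nonZeroDivisors ℤ)
    (fun p : ι × ι × ι => c p.1 p.2.1 p.2.2)
  choose d hd using hD
  have hD0 : (D : ℤ) ≠ 0 := nonZeroDivisors.ne_zero D.2
  have hD0' : (2 * (D : ℤ) : ℝ) ≠ 0 := by exact_mod_cast mul_ne_zero two_ne_zero hD0
  have hdr : ∀ i j k, (d (i, j, k) : ℝ) = (D : ℤ) * (c i j k : ℝ) := fun i j k => by
    have := hd (i, j, k)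
    simp only [algebraMap_int_eq, eq_intCast, zsmul_eq_mul] at this
    exact_mod_cast this
  -- With `D` a common denominator and `e i = 2D b i`, brackets scale by `4D²` and basis vectors by
  -- `2D`, so the new constants are `2D c`, that is, twice the integers `d`.
  let e := b.unitsSMul fun _ => Units.mk0 _ hD0'
  have he : ∀ i, e i = (2 * (D : ℤ) : ℝ) • b i := fun i => by
    simp only [e, Module.Basis.unitsSMul_apply]
    rfl
  refine ⟨e, fun i j => ⟨∑ k, d (i, j, k) • e k, ?_, ?_⟩⟩
  · exact Submodule.sum_mem _ fun k _ => Submodule.smul_mem _ _ (Submodule.subset_span ⟨k, rfl⟩)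
  · simp only [he, smul_lie, lie_smul, hc, Finset.smul_sum]
    refine Finset.sum_congr rfl fun k _ => ?_
    rw [← Int.cast_smul_eq_zsmul ℝ, hdr]
    simp only [smul_smul]
    congr 1
    ring

/-- Evenness of the structure constants cancels the `½` of the group law; this is what closes the
integral span under products. -/
lemma exists_lie_eq_two_smul_of_mem_span {ι : Type*} {e : ι → 𝔤}
    (he : ∀ i j, ∃ y ∈ Submodule.span ℤ (Set.range e), ⁅e i, e j⁆ = (2 : ℝ) • y) {x y : 𝔤}
    (hx : x ∈ Submodule.span ℤ (Set.range e)) (hy : y ∈ Submodule.span ℤ (Set.range e)) :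
    (1 / 2 : ℝ) • ⁅x, y⁆ ∈ Submodule.span ℤ (Set.range e) := by
  induction hx, hy using Submodule.span_induction₂ with
  | mem_mem x y hx hy =>
    obtain ⟨i, rfl⟩ := hx
    obtain ⟨j, rfl⟩ := hy
    obtain ⟨z, hz, h⟩ := he i j
    rw [h, smul_smul]
    norm_num [hz]
  | zero_left y hy => simp
  | zero_right x hx => simp
  | add_left x y z _ _ _ hx hy => rw [add_lie, smul_add]; exact add_mem hx hy
  | add_right x y z _ _ _ hx hy => rw [lie_add, smul_add]; exact add_mem hx hy
  | smul_left r x y _ _ h =>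
    rw [smul_lie, smul_comm]; exact Submodule.smul_mem _ _ h
  | smul_right r x y _ _ h =>
    rw [lie_smul, smul_comm]; exact Submodule.smul_mem _ _ h

variable [IsTwoStepNilpotent 𝔤]

namespace SCGroup

lemma mul_eq (p q : SCGroup 𝔤) :
    p * q = of (p.val + q.val + (1 / 2 : ℝ) • ⁅p.val, q.val⁆) := rfl

variable [Module.Finite ℝ 𝔤]

instance : IsTopologicalGroup (SCGroup 𝔤) :=
  topologicalGroup_of_lieGroup 𝓘(ℝ, Model 𝔤) ∞

instance : T2Space (SCGroup 𝔤) := inferInstanceAs (T2Space (Model 𝔤))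

instance : SecondCountableTopology (SCGroup 𝔤) :=
  have : ProperSpace (Model 𝔤) := FiniteDimensional.proper_real _
  inferInstanceAs (SecondCountableTopology (Model 𝔤))

/-- The subgroup of the elements of a lattice in the Lie algebra. -/
def lattice {ι : Type*} (e : ι → 𝔤)
    (he : ∀ i j, ∃ y ∈ Submodule.span ℤ (Set.range e), ⁅e i, e j⁆ = (2 : ℝ) • y) :
    Subgroup (SCGroup 𝔤) where
  carrier := {p | p.val ∈ Submodule.span ℤ (Set.range e)}
  mul_mem' hp hq := add_mem (add_mem hp hq) (exists_lie_eq_two_smul_of_mem_span he hp hq)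
  one_mem' := (Submodule.span ℤ (Set.range e)).zero_mem
  inv_mem' hp := (Submodule.span ℤ (Set.range e)).neg_mem hp

variable {ι : Type*} [Fintype ι]

lemma discreteTopology_lattice (e : Module.Basis ι ℝ 𝔤)
    (he : ∀ i j, ∃ y ∈ Submodule.span ℤ (Set.range e), ⁅e i, e j⁆ = (2 : ℝ) • y) :
    DiscreteTopology (lattice e he) := by
  -- The same basis in the normed copy of `𝔤`, where discreteness of an integral span is an
  -- instance.
  let e' : Module.Basis ι ℝ (Model 𝔤) := e
  exact inferInstanceAs (DiscreteTopology (Submodule.span ℤ (Set.range e')))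

/-- The basis need not be adapted to the centre, so the compact set meeting every coset is the image
of a cube with one extra coordinate for each bracket `⁅e i, e j⁆`. These redundant central
directions absorb the correction term of the product. -/
lemma compactSpace_quotient_lattice (e : Module.Basis ι ℝ 𝔤)
    (he : ∀ i j, ∃ y ∈ Submodule.span ℤ (Set.range e), ⁅e i, e j⁆ = (2 : ℝ) • y) :
    CompactSpace (SCGroup 𝔤 ⧸ lattice e he) := by
  let e' : ι → Model 𝔤 := e
  let br : ι → ι → Model 𝔤 := fun i j => (⁅e i, e j⁆ : 𝔤)
  let F : (ι → ℝ) × (ι × ι → ℝ) → Model 𝔤 :=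
    fun p => ∑ i, p.1 i • e' i + ∑ q : ι × ι, p.2 q • br q.1 q.2
  have hF : Continuous F := by fun_prop
  let π : Model 𝔤 → SCGroup 𝔤 ⧸ lattice e he := fun x => QuotientGroup.mk (of (𝔤 := 𝔤) x)
  have hπ : Continuous π := continuous_quotient_mk'
  have hK : IsCompact (Set.Icc (0 : (ι → ℝ) × (ι × ι → ℝ)) 1) := by
    rw [← Prod.mk_zero_zero, ← Prod.mk_one_one, Set.Icc_prod_eq]
    exact isCompact_Icc.prod isCompact_Icc
  have hzz : ∀ x y z : 𝔤, ⁅x, ⁅y, z⁆⁆ = 0 := IsTwoStepNilpotent.lie_lie_eq_zero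
  have hspan : ∀ t : ι → ℤ, ∑ i, t i • e i ∈ Submodule.span ℤ (Set.range e) := fun t =>
    Submodule.sum_mem _ fun k _ => Submodule.smul_mem _ _ (Submodule.subset_span ⟨k, rfl⟩)
  refine ⟨?_⟩
  convert hK.image (hπ.comp hF)
  refine (Set.eq_univ_of_forall fun m => ?_).symm
  obtain ⟨x, rfl⟩ := QuotientGroup.mk_surjective m
  let a : ι → ℝ := fun i => e.repr x.val i
  have hx : x.val = ∑ i, a i • e i := (e.sum_repr x.val).symm
  -- Coefficients of `-½⁅f, l⁆`, where `x = f + l` splits `x` into fractional and integral parts.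
  -- Splitting `s` likewise into `c + μ`, with `μ` central and integral, gives `x * (-l - μ) = f +
  -- c`.
  let s : ι × ι → ℝ := fun q => -(1 / 2) * (Int.fract (a q.1) * ⌊a q.2⌋)
  refine ⟨(fun i => Int.fract (a i), fun q => Int.fract (s q)),
    ⟨⟨fun i => Int.fract_nonneg _, fun i => Int.fract_nonneg _⟩,
      ⟨fun i => (Int.fract_lt_one _).le, fun i => (Int.fract_lt_one _).le⟩⟩, ?_⟩
  let f : 𝔤 := ∑ i, Int.fract (a i) • e i
  let l : 𝔤 := ∑ i, (⌊a i⌋ : ℤ) • e i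
  let c : 𝔤 := ∑ q : ι × ι, Int.fract (s q) • ⁅e q.1, e q.2⁆
  let μ : 𝔤 := ∑ q : ι × ι, ⌊s q⌋ • ⁅e q.1, e q.2⁆
  have hl : l ∈ Submodule.span ℤ (Set.range e) := hspan _
  have hμ : μ ∈ Submodule.span ℤ (Set.range e) := by
    refine Submodule.sum_mem _ fun q _ => Submodule.smul_mem _ _ ?_
    obtain ⟨y, hy, h⟩ := he q.1 q.2
    rw [h, two_smul]
    exact add_mem hy hy
  have hxf : x.val = f + l := by
    simp only [hx, f, l, ← Finset.sum_add_distrib]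
    refine Finset.sum_congr rfl fun i _ => ?_
    rw [← Int.cast_smul_eq_zsmul ℝ, ← add_smul, Int.fract_add_floor]
  have hfl : -((1 / 2 : ℝ) • ⁅f, l⁆) = c + μ := by
    have h1 : ⁅f, l⁆ = ∑ q : ι × ι, (Int.fract (a q.1) * ⌊a q.2⌋) • ⁅e q.1, e q.2⁆ := by
      simp only [f, l, sum_lie, lie_sum, smul_lie, lie_smul, Fintype.sum_prod_type,
        ← Int.cast_smul_eq_zsmul ℝ]
      simp only [Finset.smul_sum, smul_smul]
      rw [Finset.sum_comm]
      simp only [mul_comm]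
    have h2 : c + μ = ∑ q : ι × ι, s q • ⁅e q.1, e q.2⁆ := by
      simp only [c, μ, ← Finset.sum_add_distrib]
      refine Finset.sum_congr rfl fun i _ => ?_
      rw [← Int.cast_smul_eq_zsmul ℝ, ← add_smul, Int.fract_add_floor]
    rw [h1, h2, ← neg_smul, Finset.smul_sum]
    simp only [smul_smul, s]
  have hfm : ∀ z : 𝔤, ⁅z, μ⁆ = 0 := fun z => by simp [μ, lie_sum, hzz]
  change (QuotientGroup.mk (of (f + c)) : SCGroup 𝔤 ⧸ lattice e he) = QuotientGroup.mk x
  refine (QuotientGroup.eq.2 ?_).symm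
  have hmem : (of (-l - μ) : SCGroup 𝔤) ∈ lattice e he :=
    (sub_mem (neg_mem hl) hμ : -l - μ ∈ Submodule.span ℤ (Set.range e))
  have hprod : x * of (-l - μ) = of (f + c) := by
    rw [mul_eq]
    change (x.val + (-l - μ) + (1 / 2 : ℝ) • ⁅x.val, (-l - μ)⁆ : 𝔤) = f + c
    rw [hxf, lie_sub, hfm, sub_zero, lie_neg, add_lie, lie_self, add_zero, smul_neg, hfl]
    abel
  rw [← hprod, inv_mul_cancel_left]
  exact hmem

end SCGroup

end Lattice

/-! ### Rational bases of the cotangent Lie algebra -/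

section CotangentBasis

variable {L : Type*} [LieRing L] [LieAlgebra ℝ L]

/-- Adjoining the dual basis creates no new constants: the coadjoint action has the entries `∓c` of
the transposed adjoint matrices, and dual vectors commute. -/
lemma Cotangent.exists_rational_basis (h : HasRationalStructureConstants L) :
    ∃ (n : ℕ) (b : Module.Basis (Fin n ⊕ Fin n) ℝ (Cotangent L)),
      ∀ i j, ∃ c : Fin n ⊕ Fin n → ℚ, ⁅b i, b j⁆ = ∑ k, (c k : ℝ) • b k := by
  obtain ⟨n, b, c, hc⟩ := h
  let B : Module.Basis (Fin n ⊕ Fin n) ℝ (Cotangent L) := b.prod b.dualBasis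
  have hl₁ : ∀ i, (B (Sum.inl i)).1 = b i := b.prod_apply_inl_fst _
  have hl₂ : ∀ i, (B (Sum.inl i)).2 = 0 := b.prod_apply_inl_snd _
  have hr₁ : ∀ i, (B (Sum.inr i)).1 = 0 := b.prod_apply_inr_fst _
  have hr₂ : ∀ i, (B (Sum.inr i)).2 = b.dualBasis i := b.prod_apply_inr_snd _
  have hrl : ∀ X k, B.repr X (Sum.inl k) = b.repr X.1 k := fun X k => rfl
  have hrr : ∀ X k, B.repr X (Sum.inr k) = X.2 (b k) := fun X k => by
    change b.dualBasis.repr X.2 k = _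
    simp
  suffices h : ∀ i j k, ∃ q : ℚ, (q : ℝ) = B.repr ⁅B i, B j⁆ k by
    refine ⟨n, B, fun i j => ?_⟩
    choose q hq using h i j
    exact ⟨q, by simp_rw [hq, B.sum_repr]⟩
  have hrepr : ∀ i j k, b.repr ⁅b i, b j⁆ k = c i j k := fun i j k => by
    rw [hc, b.repr_sum_self]
  rintro (i | i) (j | j) (k | k) <;> simp only [hrl, hrr, lie_fst, lie_snd_apply, hl₁, hl₂, hr₁,
      hr₂, lie_zero, zero_lie, map_zero, Finsupp.coe_zero, Pi.zero_apply, LinearMap.zero_apply,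
      neg_zero, add_zero, zero_add, Module.Basis.dualBasis_apply, hrepr]
  · exact ⟨_, rfl⟩
  · exact ⟨0, by simp⟩
  · exact ⟨0, by simp⟩
  · exact ⟨-c i k j, by simp⟩
  · exact ⟨0, by simp⟩
  · exact ⟨_, rfl⟩
  · exact ⟨0, by simp⟩
  · exact ⟨0, by simp⟩

end CotangentBasis

/-! ### The bi-invariant metric and the right translations by a subgroup -/

section MetricLieAlgebra

open Topology

variable {𝔤 : Type*} [LieRing 𝔤] [LieAlgebra ℝ 𝔤]

/-- The linear terms cancel by skewness of `ad a`; the quadratic term vanishes on moving one `ad a`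
across, since `(ad a)² = 0`. This is the derivative of left translation by `a`. -/
lemma adInvariant_half_bracket [IsTwoStepNilpotent 𝔤] {β : LinearMap.BilinForm ℝ 𝔤}
    (hinv : ∀ X Y Z : 𝔤, β ⁅X, Y⁆ Z + β Y ⁅X, Z⁆ = 0) (a v w : 𝔤) :
    β (v + (1 / 2 : ℝ) • ⁅a, v⁆) (w + (1 / 2 : ℝ) • ⁅a, w⁆) = β v w := by
  have h0 : β ⁅a, v⁆ ⁅a, w⁆ = 0 := by
    have := hinv a v ⁅a, w⁆
    rwa [IsTwoStepNilpotent.lie_lie_eq_zero, map_zero, add_zero] at this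
  simp only [map_add, map_smul, LinearMap.add_apply, LinearMap.smul_apply, h0, smul_eq_mul]
  linarith [hinv a v w]

lemma adInvariant_half_bracket_right [IsTwoStepNilpotent 𝔤] {β : LinearMap.BilinForm ℝ 𝔤}
    (hinv : ∀ X Y Z : 𝔤, β ⁅X, Y⁆ Z + β Y ⁅X, Z⁆ = 0) (a v w : 𝔤) :
    β (v + (1 / 2 : ℝ) • ⁅v, a⁆) (w + (1 / 2 : ℝ) • ⁅w, a⁆) = β v w := by
  simpa only [neg_lie, lie_skew] using adInvariant_half_bracket hinv (-a) v w

variable [Module.Finite ℝ 𝔤]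

/-- A bilinear form on `𝔤` as a continuous bilinear map on the underlying normed space. -/
def Model.formCLM (β : LinearMap.BilinForm ℝ 𝔤) : Model 𝔤 →L[ℝ] Model 𝔤 →L[ℝ] ℝ :=
  LinearMap.toContinuousLinearMap
    ((LinearMap.toContinuousLinearMap : (Model 𝔤 →ₗ[ℝ] ℝ) ≃ₗ[ℝ] _).toLinearMap ∘ₗ
      (β : Model 𝔤 →ₗ[ℝ] Model 𝔤 →ₗ[ℝ] ℝ))

namespace SCGroup

lemma hasFDerivAt_mul_left (a x : Model 𝔤) :
    HasFDerivAt (fun q : Model 𝔤 => a + q + (1 / 2 : ℝ) • Model.bracketCLM 𝔤 a q)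
      (ContinuousLinearMap.id ℝ (Model 𝔤) + (1 / 2 : ℝ) • Model.bracketCLM 𝔤 a) x :=
  ((hasFDerivAt_id x).const_add a).add
    ((Model.bracketCLM 𝔤 a).hasFDerivAt.const_smul (1 / 2 : ℝ))

lemma hasFDerivAt_mul_right (a x : Model 𝔤) :
    HasFDerivAt (fun q : Model 𝔤 => q + a + (1 / 2 : ℝ) • Model.bracketCLM 𝔤 q a)
      (ContinuousLinearMap.id ℝ (Model 𝔤) + (1 / 2 : ℝ) • (Model.bracketCLM 𝔤).flip a) x :=
  ((hasFDerivAt_id x).add_const a).add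
    (((Model.bracketCLM 𝔤).flip a).hasFDerivAt.const_smul (1 / 2 : ℝ))

variable [IsTwoStepNilpotent 𝔤] {β : LinearMap.BilinForm ℝ 𝔤}

lemma formCLM_fderiv_mul_left (hinv : ∀ X Y Z : 𝔤, β ⁅X, Y⁆ Z + β Y ⁅X, Z⁆ = 0)
    (a x v w : Model 𝔤) :
    Model.formCLM β
      (fderiv ℝ (fun q : Model 𝔤 => a + q + (1 / 2 : ℝ) • Model.bracketCLM 𝔤 a q) x v)
      (fderiv ℝ (fun q : Model 𝔤 => a + q + (1 / 2 : ℝ) • Model.bracketCLM 𝔤 a q) x w) =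
      Model.formCLM β v w := by
  rw [(hasFDerivAt_mul_left a x).fderiv]
  exact adInvariant_half_bracket hinv a v w

lemma formCLM_fderiv_mul_right (hinv : ∀ X Y Z : 𝔤, β ⁅X, Y⁆ Z + β Y ⁅X, Z⁆ = 0)
    (a x v w : Model 𝔤) :
    Model.formCLM β
      (fderiv ℝ (fun q : Model 𝔤 => q + a + (1 / 2 : ℝ) • Model.bracketCLM 𝔤 q a) x v)
      (fderiv ℝ (fun q : Model 𝔤 => q + a + (1 / 2 : ℝ) • Model.bracketCLM 𝔤 q a) x w) =
      Model.formCLM β v w := by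
  rw [(hasFDerivAt_mul_right a x).fderiv]
  exact adInvariant_half_bracket_right hinv a v w

variable (hsymm : ∀ X Y, β X Y = β Y X) (hnd : ∀ X, (∀ Y, β X Y = 0) → X = 0)

variable (β) in
/-- The metric on the group which equals `β` at the identity. If `β` is ad-invariant, the
bi-invariant metric is constant on the vector space `𝔤`. -/
def metric : PseudoRiemannianMetric 𝓘(ℝ, Model 𝔤) (SCGroup 𝔤) :=
  PseudoRiemannianMetric.constSelf (V := Model 𝔤) (Model.formCLM β) hsymm hnd

lemma metric_isPreservedBy_mul_left (hinv : ∀ X Y Z : 𝔤, β ⁅X, Y⁆ Z + β Y ⁅X, Z⁆ = 0)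
    (a : SCGroup 𝔤) :
    (metric β hsymm hnd).IsPreservedBy (metric β hsymm hnd) (fun x => a * x) := fun x v w => by
  -- Stated on the vector space, where `mfderiv` is `fderiv`; left translation unfolds to this map.
  have key : ∀ a x v w : Model 𝔤,
      Model.formCLM β
        (mfderiv 𝓘(ℝ, Model 𝔤) 𝓘(ℝ, Model 𝔤)
          (fun q : Model 𝔤 => a + q + (1 / 2 : ℝ) • Model.bracketCLM 𝔤 a q) x v)
        (mfderiv 𝓘(ℝ, Model 𝔤) 𝓘(ℝ, Model 𝔤)
          (fun q : Model 𝔤 => a + q + (1 / 2 : ℝ) • Model.bracketCLM 𝔤 a q) x w) =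
        Model.formCLM β v w := fun a x v w => by
    rw [mfderiv_eq_fderiv]
    exact formCLM_fderiv_mul_left hinv a x v w
  exact key a x v w

lemma metric_isPreservedBy_mul_right (hinv : ∀ X Y Z : 𝔤, β ⁅X, Y⁆ Z + β Y ⁅X, Z⁆ = 0)
    (a : SCGroup 𝔤) :
    (metric β hsymm hnd).IsPreservedBy (metric β hsymm hnd) (fun x => x * a) := fun x v w => by
  have key : ∀ a x v w : Model 𝔤,
      Model.formCLM β
        (mfderiv 𝓘(ℝ, Model 𝔤) 𝓘(ℝ, Model 𝔤)
          (fun q : Model 𝔤 => q + a + (1 / 2 : ℝ) • Model.bracketCLM 𝔤 q a) x v)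
        (mfderiv 𝓘(ℝ, Model 𝔤) 𝓘(ℝ, Model 𝔤)
          (fun q : Model 𝔤 => q + a + (1 / 2 : ℝ) • Model.bracketCLM 𝔤 q a) x w) =
        Model.formCLM β v w := fun a x v w => by
    rw [mfderiv_eq_fderiv]
    exact formCLM_fderiv_mul_right hinv a x v w
  exact key a x v w

variable (Γ : Subgroup (SCGroup 𝔤))

lemma isLocalHomeomorph_mk [DiscreteTopology Γ] :
    IsLocalHomeomorph (fun x : Model 𝔤 => (QuotientGroup.mk (s := Γ) x)) :=
  (Γ.isQuotientCoveringMap (⟨inferInstance⟩)).isCoveringMap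
    |>.isLocalHomeomorph

lemma hasIsometricDeckMaps_mk (hinv : ∀ X Y Z : 𝔤, β ⁅X, Y⁆ Z + β Y ⁅X, Z⁆ = 0) :
    HasIsometricDeckMaps (fun x : Model 𝔤 => (QuotientGroup.mk (s := Γ) x)) (Model.formCLM β) := by
  intro x y hxy
  have hγ := QuotientGroup.eq.1 hxy
  -- Points of one left coset differ by right translation by `x⁻¹ y ∈ Γ`, so right invariance of the
  -- form is what is needed here.
  let γ : Model 𝔤 := (of (𝔤 := 𝔤) x)⁻¹ * of (𝔤 := 𝔤) y
  refine ⟨fun z : Model 𝔤 => z + γ + (1 / 2 : ℝ) • Model.bracketCLM 𝔤 z γ, by fun_prop,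
    mul_inv_cancel_left (of (𝔤 := 𝔤) x) (of (𝔤 := 𝔤) y), fun z => ?_,
    fun z => formCLM_fderiv_mul_right hinv γ z⟩
  exact QuotientGroup.mk_mul_of_mem (s := Γ) (of (𝔤 := 𝔤) z) hγ

end SCGroup

end MetricLieAlgebra

/-! ### Lie algebras of discrete subgroups -/

section Reductive

variable {E : Type*} [NormedAddCommGroup E] [NormedSpace ℝ E] {H : Type*} [TopologicalSpace H]
  {I : ModelWithCorners ℝ E H}
  {G : Type*} [TopologicalSpace G] [ChartedSpace H G] [Group G]

lemma mulInvariantVectorField_one (X : GroupLieAlgebra I G) :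
    mulInvariantVectorField X (1 : G) = X := by
  have h : HasMFDerivAt I I (fun x : G => 1 * x) 1 (ContinuousLinearMap.id ℝ E) :=
    (hasMFDerivAt_id 1).congr_of_eventuallyEq (Filter.Eventually.of_forall one_mul)
  exact congrArg (fun L => L X) h.mfderiv

/-- The Lie algebra of a discrete subgroup is trivial. -/
lemma isLieAlgebraOf_bot (Γ : Subgroup G) [DiscreteTopology Γ] :
    IsLieAlgebraOf I (⊥ : Submodule ℝ (GroupLieAlgebra I G)) Γ := by
  intro X
  rw [Submodule.mem_bot]
  constructor
  · rintro rfl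
    refine ⟨fun _ => 1, rfl, ?_, fun _ => Γ.one_mem⟩
    refine isMIntegralCurve_const ?_
    exact mulInvariantVectorField_one 0
  · rintro ⟨γ, hγ0, hγ, hγΓ⟩
    have hc : Continuous γ := hγ.continuous
    -- A continuous curve in a discrete set is constant; its velocity at `0`, which is `X`,
    -- therefore vanishes.
    have hconst : ∀ t, γ t = 1 := fun t => by
      have : Continuous fun t => (⟨γ t, hγΓ t⟩ : Γ) := hc.subtype_mk _
      have h := PreconnectedSpace.constant (inferInstanceAs (PreconnectedSpace ℝ)) this
        (x := t) (y := 0)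
      rw [← hγ0]
      exact congrArg Subtype.val h
    obtain rfl : γ = fun _ => 1 := funext hconst
    have h1 := (hγ 0).mfderiv
    rw [mfderiv_const] at h1
    have h2 := congrArg (fun L => L (1 : ℝ)) h1
    have h3 : mulInvariantVectorField X (1 : G) = 0 := 
      (one_smul ℝ _).symm.trans h2.symm
    rwa [mulInvariantVectorField_one] at h3

end Reductive

/-! ### Natural reductivity of quotients by discrete subgroups -/

section Quotient

open Topology

variable {E : Type*} [NormedAddCommGroup E] [NormedSpace ℝ E] {H : Type*} [TopologicalSpace H]
  {I : ModelWithCorners ℝ E H}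
  {G : Type*} [TopologicalSpace G] [ChartedSpace H G] [Group G] [LieGroup I ∞ G]
  {E' : Type*} [NormedAddCommGroup E'] [NormedSpace ℝ E'] {H' : Type*}
  [TopologicalSpace H'] {I' : ModelWithCorners ℝ E' H'}
  {Γ : Subgroup G} [ChartedSpace H' (G ⧸ Γ)]

/-- With `s` a local smooth section of the projection, the action is locally `(a, m) ↦ π (a * s m)`.
-/
lemma contMDiffSMul_quotient
    (hπ : IsLocalDiffeomorph I I' ∞ (QuotientGroup.mk : G → G ⧸ Γ)) :
    ContMDiffSMul I I' ∞ G (G ⧸ Γ) where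
  contMDiff_smul := by
    rintro ⟨a, m⟩
    obtain ⟨x, rfl⟩ := QuotientGroup.mk_surjective m
    have hx := hπ x
    let s := hx.localInverse
    have hs : ContMDiffAt I' I ∞ s (QuotientGroup.mk x) := hx.localInverse_contMDiffAt
    have h1 : ContMDiffAt (I.prod I') I' ∞
        (fun p : G × (G ⧸ Γ) => (QuotientGroup.mk (p.1 * s p.2) : G ⧸ Γ))
        (a, QuotientGroup.mk x) :=
      (hπ.contMDiff _).comp _ (contMDiffAt_fst.mul
        (hs.comp (a, (QuotientGroup.mk x : G ⧸ Γ)) contMDiffAt_snd))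
    refine h1.congr_of_eventuallyEq ?_
    have h2 : ∀ᶠ m in 𝓝 (QuotientGroup.mk x : G ⧸ Γ), QuotientGroup.mk (s m) = m :=
      hx.localInverse_eventuallyEq_right
    filter_upwards [continuousAt_snd.eventually h2] with p hp
    conv_lhs => rw [← hp]
    rfl

/-- An element acting trivially fixes the base coset, so the kernel lies in `Γ`. -/
lemma discreteTopology_ker_toPermHom_quotient [DiscreteTopology Γ] :
    DiscreteTopology (MulAction.toPermHom G (G ⧸ Γ)).ker := by
  refine DiscreteTopology.of_subset (s := (Γ : Set G)) inferInstance fun a ha => ?_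
  have h : a • (QuotientGroup.mk 1 : G ⧸ Γ) = QuotientGroup.mk 1 :=
    congrArg (fun f : Equiv.Perm (G ⧸ Γ) => f (QuotientGroup.mk 1)) (MonoidHom.mem_ker.1 ha)
  have h' : (QuotientGroup.mk (a * 1) : G ⧸ Γ) = QuotientGroup.mk 1 := h
  have := QuotientGroup.eq.1 h'.symm
  simpa using this

variable [IsManifold I' ∞ (G ⧸ Γ)] {h : PseudoRiemannianMetric I G}
  {g : PseudoRiemannianMetric I' (G ⧸ Γ)}

/-- The orbit map of the base coset is the projection itself, a local isometry. -/
lemma pullbackForm_mk_one (hgh : h.IsPreservedBy g (QuotientGroup.mk : G → G ⧸ Γ))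
    (X Y : GroupLieAlgebra I G) :
    pullbackForm I I' g (QuotientGroup.mk 1 : G ⧸ Γ) X Y = h.val 1 X Y := by
  have key : ∀ f f' : G → G ⧸ Γ, f = f' → ∀ m, m = f' 1 →
      g.val m (mfderiv I I' f 1 X : E') (mfderiv I I' f 1 Y : E') =
        g.val (f' 1) (mfderiv I I' f' 1 X) (mfderiv I I' f' 1 Y) := by
    rintro f _ rfl m rfl
    rfl
  have hf : (fun a : G => a • (QuotientGroup.mk 1 : G ⧸ Γ)) = QuotientGroup.mk :=
    funext fun a => congrArg QuotientGroup.mk (mul_one a)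
  exact (key _ _ hf _ (one_smul _ _)).trans (hgh 1 X Y)

/-- A quotient of a Lie group with a bi-invariant metric by a discrete subgroup is naturally
reductive with respect to the left translations. -/
lemma isNaturallyReductive_quotient [T2Space G] [SecondCountableTopology G] [DiscreteTopology Γ]
    (hπ : IsLocalDiffeomorph I I' ∞ (QuotientGroup.mk : G → G ⧸ Γ))
    (hgh : h.IsPreservedBy g (QuotientGroup.mk : G → G ⧸ Γ))
    (hleft : ∀ a : G, h.IsPreservedBy h (fun x => a * x))
    (hinv : ∀ X Y Z : GroupLieAlgebra I G, h.val 1 ⁅X, Y⁆ Z + h.val 1 Y ⁅X, Z⁆ = 0) :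
    IsNaturallyReductive I G I' g where
  t2 := inferInstance
  secondCountable := inferInstance
  smooth := contMDiffSMul_quotient hπ
  transitive := inferInstance
  almostEffective := discreteTopology_ker_toPermHom_quotient
  isometry a := by
    have := contMDiffSMul_quotient hπ
    have hsmul : ContMDiff I' I' ∞ (fun m : G ⧸ Γ => a • m) :=
      (ContMDiffSMul.contMDiff_smul (I := I) (I' := I') (n := ∞) (G := G) (M := G ⧸ Γ)).comp
        (contMDiff_const.prodMk contMDiff_id)
    exact hgh.descend hπ QuotientGroup.mk_surjective (hleft a)
      ((contMDiff_mul_left (I := I) (n := ∞) (a := a)).mdifferentiable (by simp))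
      (hsmul.mdifferentiable (by simp)) rfl
  exists_reductive := by
    refine ⟨QuotientGroup.mk 1, ⊥, ⊤, isCompl_top_bot, ?_, fun _ _ _ _ => Submodule.mem_top, ?_⟩
    · have : MulAction.stabilizer G (QuotientGroup.mk 1 : G ⧸ Γ) = Γ :=
        MulAction.stabilizer_quotient Γ
      rw [this]
      exact isLieAlgebraOf_bot Γ
    · intro X _ Y _ Z _
      have hproj : ∀ W : GroupLieAlgebra I G,
          (⊤ : Submodule ℝ (GroupLieAlgebra I G)).projection ⊥ isCompl_top_bot W = W := fun W =>
        Submodule.projection_apply_left _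
          (⟨W, Submodule.mem_top⟩ : (⊤ : Submodule ℝ (GroupLieAlgebra I G)))
      rw [hproj, hproj, pullbackForm_mk_one hgh, pullbackForm_mk_one hgh]
      exact hinv X Y Z

end Quotient

/-! ### The canonical neutral form -/

section CotangentForm

variable {L : Type*} [LieRing L] [LieAlgebra ℝ L]

namespace Cotangent

/-- The terms in `Y.2` and `Z.2` cancel by definition of the coadjoint action, those in `X.2` by
antisymmetry of the bracket. -/
lemma canonicalForm_lie (X Y Z : Cotangent L) :
    canonicalForm ⁅X, Y⁆ Z + canonicalForm Y ⁅X, Z⁆ = 0 := by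
  simp only [canonicalForm, lie_fst, lie_snd_apply]
  rw [← lie_skew Z.1 Y.1, map_neg]
  ring

variable (L) in
/-- The canonical neutral form as a bilinear form. -/
def canonicalBilinForm : LinearMap.BilinForm ℝ (Cotangent L) :=
  LinearMap.mk₂ ℝ canonicalForm
    (fun X X' Y => by simp [canonicalForm, add_fst, add_snd]; ring)
    (fun t X Y => by simp [canonicalForm, smul_fst, smul_snd]; ring)
    (fun X Y Y' => by simp [canonicalForm, add_fst, add_snd]; ring)
    (fun t X Y => by simp [canonicalForm, smul_fst, smul_snd]; ring)

lemma canonicalBilinForm_apply (X Y : Cotangent L) :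
    canonicalBilinForm L X Y = canonicalForm X Y := rfl

lemma canonicalBilinForm_symm (X Y : Cotangent L) :
    canonicalBilinForm L X Y = canonicalBilinForm L Y X := by
  simp only [canonicalBilinForm_apply, canonicalForm, add_comm]

lemma eq_zero_of_canonicalBilinForm_eq_zero (X : Cotangent L)
    (h : ∀ Y, canonicalBilinForm L X Y = 0) : X = 0 := by
  refine ext' ?_ fun z => ?_
  · refine (Module.forall_dual_apply_eq_zero_iff ℝ X.1).1 fun η => ?_
    have h' : X.2 0 + η X.1 = 0 := h ((0, η) : L × Module.Dual ℝ L)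
    rwa [map_zero, zero_add] at h'
  · have h' : X.2 z + 0 = 0 := h ((z, 0) : L × Module.Dual ℝ L)
    rwa [add_zero] at h'

end Cotangent

end CotangentForm

end NilGeom
end
-- The theorem
open NilGeom in
theorem proposition2 {E : Type*} [NormedAddCommGroup E] [NormedSpace ℝ E] [FiniteDimensional ℝ E]
    {N : Type*} [TopologicalSpace N] [ChartedSpace E N] [Group N] [LieGroup 𝓘(ℝ, E) ∞ N]
    [IsTwoStepNilpotent (GroupLieAlgebra 𝓘(ℝ, E) N)]
    (hN : HasRationalStructureConstants (GroupLieAlgebra 𝓘(ℝ, E) N)) :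
    -- the canonical form on `T*𝔫` is ad-invariant
    (∀ X Y Z : CotangentLieAlgebra E N,
      Cotangent.canonicalForm ⁅X, Y⁆ Z + Cotangent.canonicalForm Y ⁅X, Z⁆ = 0) ∧
    -- it induces a bi-invariant metric `h` on `T*N`
    ∃ h : PseudoRiemannianMetric (cotangentModel E N) (CotangentGroup E N),
      (∀ X Y : GroupLieAlgebra (cotangentModel E N) (CotangentGroup E N),
        h.val 1 X Y =
          Cotangent.canonicalForm (SCGroup.lieAlgebraEquiv X) (SCGroup.lieAlgebraEquiv Y)) ∧
      (∀ a : CotangentGroup E N, h.IsPreservedBy h (fun x ↦ a * x)) ∧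
      (∀ a : CotangentGroup E N, h.IsPreservedBy h (fun x ↦ x * a)) ∧
      -- `T*N` has a discrete cocompact subgroup `Γ`
      ∃ Γ : Subgroup (CotangentGroup E N),
        DiscreteTopology Γ ∧ CompactSpace (CotangentGroup E N ⧸ Γ) ∧
        T2Space (CotangentGroup E N ⧸ Γ) ∧
        -- the quotient manifold `(T*N)/Γ` with the metric `g` induced by `h`
        ∃ (_ : ChartedSpace (Model (CotangentLieAlgebra E N)) (CotangentGroup E N ⧸ Γ))
          (_ : IsManifold (cotangentModel E N) ∞ (CotangentGroup E N ⧸ Γ))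
          (g : PseudoRiemannianMetric (cotangentModel E N) (CotangentGroup E N ⧸ Γ)),
          IsLocalDiffeomorph (cotangentModel E N) (cotangentModel E N) ∞
            (QuotientGroup.mk : CotangentGroup E N → CotangentGroup E N ⧸ Γ) ∧
          h.IsPreservedBy g (QuotientGroup.mk : CotangentGroup E N → CotangentGroup E N ⧸ Γ) ∧
          IsNaturallyReductive (cotangentModel E N) (CotangentGroup E N) (cotangentModel E N) g := by
  refine ⟨Cotangent.canonicalForm_lie, ?_⟩
  obtain ⟨n, b, hb⟩ := Cotangent.exists_rational_basis hN
  obtain ⟨e, he⟩ := exists_basis_lie_eq_two_smul b hb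
  let β := Cotangent.canonicalBilinForm (GroupLieAlgebra 𝓘(ℝ, E) N)
  have hsymm : ∀ X Y, β X Y = β Y X := Cotangent.canonicalBilinForm_symm
  have hnd : ∀ X, (∀ Y, β X Y = 0) → X = 0 := Cotangent.eq_zero_of_canonicalBilinForm_eq_zero
  have hinv : ∀ X Y Z, β ⁅X, Y⁆ Z + β Y ⁅X, Z⁆ = 0 := Cotangent.canonicalForm_lie
  let Γ := SCGroup.lattice e he
  have hΓ : DiscreteTopology Γ := SCGroup.discreteTopology_lattice e he
  -- Closedness of `Γ` yields the Hausdorff quotient, found below by instance search.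
  have hΓc : IsClosed (Γ : Set (CotangentGroup E N)) := Γ.isClosed_of_discrete
  have hleft := SCGroup.metric_isPreservedBy_mul_left hsymm hnd hinv
  refine ⟨SCGroup.metric β hsymm hnd, fun X Y => rfl, hleft,
    SCGroup.metric_isPreservedBy_mul_right hsymm hnd hinv, Γ, hΓ,
    SCGroup.compactSpace_quotient_lattice e he, inferInstance, ?_⟩
  have hlh := SCGroup.isLocalHomeomorph_mk Γ
  have hT := SCGroup.hasIsometricDeckMaps_mk Γ hinv
  let hc : ChartedSpace (Model (CotangentLieAlgebra E N)) (CotangentGroup E N ⧸ Γ) :=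
    localInverseChartedSpace hlh (QuotientGroup.mk_surjective (s := Γ))
  have hm : IsManifold (cotangentModel E N) ∞ (CotangentGroup E N ⧸ Γ) :=
    hT.isManifold fun _ h => h
  have hπ : IsLocalDiffeomorph (cotangentModel E N) (cotangentModel E N) ∞
      (QuotientGroup.mk : CotangentGroup E N → CotangentGroup E N ⧸ Γ) :=
    isLocalDiffeomorph_of_atlas hlh fun _ h => h
  let g : PseudoRiemannianMetric (cotangentModel E N) (CotangentGroup E N ⧸ Γ) :=
    hT.metric (fun _ h => h) hsymm hnd
  have hgh : (SCGroup.metric β hsymm hnd).IsPreservedBy g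
      (QuotientGroup.mk : CotangentGroup E N → CotangentGroup E N ⧸ Γ) :=
    hT.isPreservedBy (fun _ h => h) hsymm hnd (hπ.mdifferentiable (by simp))
  refine ⟨hc, hm, g, hπ, hgh, isNaturallyReductive_quotient hπ hgh hleft fun X Y Z => ?_⟩
  have h := hinv (SCGroup.lieAlgebraEquiv X) (SCGroup.lieAlgebraEquiv Y)
    (SCGroup.lieAlgebraEquiv Z)
  -- Reductivity concerns the bracket of left-invariant vector fields; `lieAlgebraEquiv` identifies
  -- it with the bracket of `T*𝔫`.
  rw [← LieEquiv.map_lie, ← LieEquiv.map_lie] at h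
  exact h
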